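/- Let $n\ge 1$, $A\in\mathbb{R}^{n\times n}$, $Q=A^TA$ with $Q_{ii}\neq 0$ for all $i$, and let $b$ be in the range of $A$. Put $f(x)=\frac12\|Ax-b\|^2$ (Euclidean norm) and $f^*=\min_x f(x)$. Let $\Gamma$ be the lower triangular part of $Q$ (diagonal included), $D$ the diagonal part of $Q$, and $$B=\begin{bmatrix}1&0\\0&(\Gamma^{-T})_{2:n}\end{bmatrix}\begin{bmatrix}1&0\\0&D_{2:n}\end{bmatrix},$$ where $M_{2:n}$ is $M$ without its first row and first column. Let $x^0\in\mathbb{R}^n$ be arbitrary and let $(x^k)$ be generated by coordinate descent with Gaussian back substitution (GBS-CD): epoch $k$ first computes, for $i=1,\dots,n$ in turn, $\tilde x_i\in\operatorname{argmin}_{t} f(\tilde x_1,\dots,\tilde x_{i-1},t,x^k_{i+1},\dots,x^k_n)$, and then sets $x^{k+1}=x^k-B(x^k-\tilde x)$. Let $L=\lambda_{\max}(Q)$, let $\kappa=\lambda_{\max}(Q)/\lambda_{\min}(Q)$ with $\lambda_{\min}(Q)$ the smallest nonzero eigenvalue of $Q$, and let $L_i=Q_{ii}$, $L_{\min}=\min_i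 L_i$. Then for all $k\ge 0$ $$f(x^{k+1})-f^*\le\left(1-\frac{L_{\min}}{\kappa\cdot\min\{\sum_i L_i,\ (2+\frac1\pi\log n)^2L\}}\right)^2\,(f(x^k)-f^*).$$ In particular, if $L_i\ge 1$ for all $i$ (for instance in the normalized case $Q_{ii}=1$), then for all $k\ge0$ $$f(x^{k+1})-f^*\le\left(1-\frac{1}{\kappa\cdot\min\{\sum_i L_i,\ (2+\frac1\pi\log n)^2L\}}\right)^2\,(f(x^k)-f^*).$$ -/

import Mathlib

open scoped Matrix

noncomputable section

namespace GBSCD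

/-- The least-squares objective `f(x) = (1/2) ‖A x - b‖²` (Euclidean norm). -/
def objective {n : ℕ} (A : Matrix (Fin n) (Fin n) ℝ) (b x : Fin n → ℝ) : ℝ :=
  (1 / 2) * ‖WithLp.toLp 2 (A *ᵥ x - b)‖ ^ 2

/-- The optimal value `f*`; the objective is nonnegative, so the infimum is a genuine one. -/
def optValue {n : ℕ} (A : Matrix (Fin n) (Fin n) ℝ) (b : Fin n → ℝ) : ℝ :=
  ⨅ x : Fin n → ℝ, objective A b x

/-- The matrix `Q = Aᵀ A`. -/
def gram {n : ℕ} (A : Matrix (Fin n) (Fin n) ℝ) : Matrix (Fin n) (Fin n) ℝ :=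
  Aᵀ * A

/-- The lower triangular part of a matrix, diagonal included (the matrix `Γ` of `Q`). -/
def lowerPart {n : ℕ} (Q : Matrix (Fin n) (Fin n) ℝ) : Matrix (Fin n) (Fin n) ℝ :=
  Matrix.of fun i j => if j ≤ i then Q i j else 0

/-- The block matrix `[1, 0; 0, M_{2:n}]`: the first row and the first column of `M` are replaced
by those of the identity matrix. -/
def borderFirst {n : ℕ} [NeZero n] (M : Matrix (Fin n) (Fin n) ℝ) : Matrix (Fin n) (Fin n) ℝ :=
  Matrix.of fun i j => if i = 0 ∨ j = 0 then (if i = j then 1 else 0) else M i j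

/-- The correction matrix `B = [1, 0; 0, (Γ⁻ᵀ)_{2:n}] [1, 0; 0, D_{2:n}]`, where `D` is the
diagonal part of `Q`. -/
def correction {n : ℕ} [NeZero n] (Q : Matrix (Fin n) (Fin n) ℝ) : Matrix (Fin n) (Fin n) ℝ :=
  borderFirst (((lowerPart Q)⁻¹)ᵀ) * borderFirst (Matrix.diagonal Q.diag)

/-- The point `(y₁, …, y_{i-1}, t, x_{i+1}, …, x_n)`. -/
def sweepPoint {n : ℕ} (x y : Fin n → ℝ) (i : Fin n) (t : ℝ) : Fin n → ℝ :=
  fun j => if j < i then y j else if j = i then t else x j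

/-- The prediction step, one epoch of cyclic coordinate descent from `x` to `y`: for
`i = 1, …, n` in turn, `y i` minimizes `t ↦ f(y₁, …, y_{i-1}, t, x_{i+1}, …, x_n)`. -/
def IsPrediction {n : ℕ} (A : Matrix (Fin n) (Fin n) ℝ) (b x y : Fin n → ℝ) : Prop :=
  ∀ i, IsMinOn (fun t : ℝ => objective A b (sweepPoint x y i t)) Set.univ (y i)

/-- One epoch of GBS-CD from `x` to `x'`: a prediction `y`, then the correction
`x' = x - B (x - y)`. -/
def IsEpoch {n : ℕ} [NeZero n] (A : Matrix (Fin n) (Fin n) ℝ) (b x x' : Fin n → ℝ) : Prop :=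
  ∃ y, IsPrediction A b x y ∧ x' = x - correction (gram A) *ᵥ (x - y)

/-- Largest eigenvalue (of a symmetric matrix). -/
def lamMax {n : ℕ} (Q : Matrix (Fin n) (Fin n) ℝ) : ℝ :=
  sSup (spectrum ℝ Q)

/-- Smallest nonzero eigenvalue (of a symmetric matrix). -/
def lamMin {n : ℕ} (Q : Matrix (Fin n) (Fin n) ℝ) : ℝ :=
  sInf {μ : ℝ | μ ∈ spectrum ℝ Q ∧ μ ≠ 0}

/-- The condition number `κ`. -/
def cond {n : ℕ} (Q : Matrix (Fin n) (Fin n) ℝ) : ℝ :=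
  lamMax Q / lamMin Q

/-- The smallest diagonal entry `L_min = min_i L_i`, where `L_i = Q_ii`. -/
def diagMin {n : ℕ} (Q : Matrix (Fin n) (Fin n) ℝ) : ℝ :=
  ⨅ i, Q i i

/-- The quantity `κ · min {∑ L_i, (2 + log n / π)² L}`, where `L_i = Q_ii` and `L` is the largest
eigenvalue of `Q`, that is, the Lipschitz constant of the gradient of the objective. -/
def complexity {n : ℕ} (Q : Matrix (Fin n) (Fin n) ℝ) : ℝ :=
  cond Q * min (∑ i, Q i i) ((2 + 1 / Real.pi * Real.log n) ^ 2 * lamMax Q)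

end GBSCD

end

/-!
Let `x⋆` be a solution of `A x⋆ = b`, let `e = x - x⋆`, and let `v = x - y` be the displacement of
the prediction sweep. Then `f(x) - f* = (1/2) eᵀ Q e`, and the optimality conditions of the sweep
read `Γ v = Q e` (`IsPrediction.lowerPart_mulVec_sub`). Write `D` for the diagonal part of `Q` and
`U` for its strictly upper part.

*The sweep and the correction.* The sweep decreases `eᵀ Q e` by exactly `vᵀ D v`
(`dotProduct_mulVec_sub_eq`). The correction step is a backward sweep over the coordinates
`n, …, 2`, so it does not increase `f` (`dotProduct_mulVec_correction_le`). It is therefore enough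
to show `2 ρ eᵀ Q e ≤ vᵀ D v` for `ρ = L_min / complexity`, as `1 - 2 ρ ≤ (1 - ρ)²`.

*The gap in terms of the decrease.* With `p = v - e` one has `Q p = U v` and
`eᵀ Q e = vᵀ D v + pᵀ Q p ≤ vᵀ D v + ‖U v‖² / λ_min`. So a bound `‖U‖² ≤ N` with
`2 (L_min λ_min + N) ≤ L · min {∑ L_i, (2 + log n / π)² L}` suffices
(`lamMin_mul_dotProduct_le_of_strictUpper`).

*The trace bound.* The Frobenius norms satisfy `2 ‖U‖² = ‖Q‖² - ∑ L_i² ≤ L ∑ L_i - ∑ L_i²`, and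
`2 L_min λ_min ≤ ∑ L_i²` as soon as `2 λ_min ≤ ∑ L_i`. This fails only if `Q` has rank one, and
then one sweep reaches the minimum (`dotProduct_mulVec_sub_eq_zero_of_trace_lt`).

*The logarithmic bound.* Since `Q` is positive semidefinite, `Q - L / 2` has norm at most `L / 2`,
and `2 U = (Q - L / 2) - (D - L / 2) - K` where `K` is the Schur product of `Q - L / 2` with
`sign (p - q)`. On `(-n, n)` the sign function is the average over the odd multiples `θ` of `π / n`
of `cot (θ / 2) sin (k θ)` (`sum_cot_mul_sin_eq`), so `K` is a combination of products of
`Q - L / 2` with diagonal matrices of cosines and sines, and its norm is at most `L / 2` times the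
mean of `|cot (θ / 2)|`, which is at most `(2 / π) (2 + log n)` (`two_mul_dotProduct_signPart_le`).
-/

namespace GBSCD

/-! ### Sums over odd multiples of `π / n` -/

theorem sum_cos_odd_mul_eq_zero {n k : ℕ} (hk : 0 < k) (hkn : k < n) :
    ∑ m ∈ Finset.range n, Real.cos (k * ((2 * m + 1) * Real.pi / n)) = 0 := by
  have hn : (0 : ℝ) < n := by exact_mod_cast hk.trans hkn
  have hk' : (0 : ℝ) < k := by exact_mod_cast hk
  have hkn' : (k : ℝ) < n := by exact_mod_cast hkn
  set φ : ℝ := k * Real.pi / n with hφ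
  have hsin : Real.sin φ ≠ 0 := by
    refine (Real.sin_pos_of_pos_of_lt_pi (by positivity) ?_).ne'
    rw [hφ, div_lt_iff₀ hn]
    nlinarith [Real.pi_pos]
  -- multiplied by `2 sin φ`, the sum telescopes
  have htel : ∀ N : ℕ, 2 * Real.sin φ *
      ∑ m ∈ Finset.range N, Real.cos (k * ((2 * m + 1) * Real.pi / n)) =
        Real.sin (2 * N * φ) := by
    intro N
    induction N with
    | zero => simp
    | succ N ih =>
      rw [Finset.sum_range_succ, mul_add, ih]
      have h1 : (k : ℝ) * ((2 * N + 1) * Real.pi / n) = 2 * N * φ + φ := by rw [hφ]; ring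
      have h2 : 2 * ((N + 1 : ℕ) : ℝ) * φ = (2 * N * φ + φ) + φ := by push_cast; ring
      have h3 : 2 * (N : ℝ) * φ = (2 * N * φ + φ) - φ := by ring
      rw [h1, h2, Real.sin_add (2 * N * φ + φ) φ]
      nth_rewrite 1 [h3]
      rw [Real.sin_sub]
      ring
  have h := htel n
  have h0 : 2 * (n : ℝ) * φ = (2 * k : ℕ) * Real.pi := by
    rw [hφ]; push_cast; field_simp
  rw [h0, Real.sin_nat_mul_pi] at h
  simpa [hsin] using h

/-- The conjugate kernel sampled at the odd multiples of `π / n` has constant sine coefficients,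
since `cot (θ / 2) (sin ((k + 1) θ) - sin (k θ)) = cos ((k + 1) θ) + cos (k θ)`. -/
theorem sum_cot_mul_sin_eq {n k : ℕ} (hk : 0 < k) (hkn : k < n) :
    ∑ m ∈ Finset.range n, Real.cot ((2 * m + 1) * Real.pi / n / 2) *
      Real.sin (k * ((2 * m + 1) * Real.pi / n)) = n := by
  have hn : (0 : ℝ) < n := by exact_mod_cast hk.trans hkn
  have hstep : ∀ j : ℕ, ∑ m ∈ Finset.range n, Real.cot ((2 * m + 1) * Real.pi / n / 2) *
      Real.sin ((j + 1 : ℕ) * ((2 * m + 1) * Real.pi / n)) =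
      ∑ m ∈ Finset.range n, Real.cot ((2 * m + 1) * Real.pi / n / 2) *
        Real.sin (j * ((2 * m + 1) * Real.pi / n)) +
      (∑ m ∈ Finset.range n, Real.cos ((j + 1 : ℕ) * ((2 * m + 1) * Real.pi / n)) +
        ∑ m ∈ Finset.range n, Real.cos (j * ((2 * m + 1) * Real.pi / n))) := by
    intro j
    rw [← Finset.sum_add_distrib, ← Finset.sum_add_distrib]
    refine Finset.sum_congr rfl fun m hm => ?_
    have hmn : (m : ℝ) + 1 ≤ n := by exact_mod_cast Finset.mem_range.mp hm
    set t : ℝ := (2 * m + 1) * Real.pi / n with ht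
    have hs : Real.sin (t / 2) ≠ 0 := by
      refine (Real.sin_pos_of_pos_of_lt_pi (by positivity) ?_).ne'
      rw [ht, div_div, div_lt_iff₀ (by positivity)]
      nlinarith [Real.pi_pos]
    have e1 : ((j + 1 : ℕ) : ℝ) * t = (j * t + t / 2) + t / 2 := by push_cast; ring
    have e2 : (j : ℝ) * t = (j * t + t / 2) - t / 2 := by ring
    rw [e1]
    nth_rewrite 2 4 [e2]
    rw [Real.sin_add (j * t + t / 2), Real.sin_sub (j * t + t / 2), Real.cos_add (j * t + t / 2),
      Real.cos_sub (j * t + t / 2), Real.cot_eq_cos_div_sin]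
    field_simp
    ring
  induction k with
  | zero => exact absurd hk (lt_irrefl 0)
  | succ k ih =>
    rw [hstep, sum_cos_odd_mul_eq_zero k.succ_pos hkn, zero_add]
    rcases Nat.eq_zero_or_pos k with rfl | hk0
    · simp
    · rw [ih hk0 (by omega), sum_cos_odd_mul_eq_zero hk0 (by omega), add_zero]

theorem sum_one_div_odd_le {n : ℕ} (hn : 0 < n) :
    ∑ m ∈ Finset.range n, (1 : ℝ) / (2 * m + 1) ≤ 1 + Real.log n / 2 := by
  induction n, hn using Nat.le_induction with
  | base => simp
  | succ n hn ih =>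
    have hn' : (0 : ℝ) < n := by exact_mod_cast hn
    rw [Finset.sum_range_succ]
    have h1 := Real.le_log_one_add_of_nonneg (x := 1 / (n : ℝ)) (by positivity)
    have h2 : 2 * (1 / (n : ℝ)) / (1 / n + 2) = 2 * (1 / (2 * n + 1)) := by
      field_simp; ring
    have h3 : Real.log (1 + 1 / (n : ℝ)) = Real.log (n + 1 : ℕ) - Real.log n := by
      rw [← Real.log_div (by positivity) hn'.ne']
      congr 1; push_cast; field_simp
    rw [h2, h3] at h1
    linarith

theorem abs_cot_le {x : ℝ} (h0 : 0 < x) (hπ : x < Real.pi) :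
    |Real.cot x| ≤ 1 / x + 1 / (Real.pi - x) := by
  have key : ∀ z : ℝ, 0 < z → z ≤ Real.pi / 2 → 0 ≤ Real.cot z ∧ Real.cot z ≤ 1 / z := by
    intro z hz hz2
    have hs : 0 < Real.sin z := Real.sin_pos_of_pos_of_lt_pi hz (by linarith [Real.pi_pos])
    have hc : 0 ≤ Real.cos z := Real.cos_nonneg_of_neg_pi_div_two_le_of_le (by linarith) hz2
    rw [Real.cot_eq_cos_div_sin]
    refine ⟨by positivity, ?_⟩
    rw [div_le_div_iff₀ hs hz]
    rcases hz2.eq_or_lt with h | h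
    · rw [h, Real.cos_pi_div_two, Real.sin_pi_div_two]; norm_num
    · have hc' : 0 < Real.cos z := Real.cos_pos_of_mem_Ioo ⟨by linarith, h⟩
      have ht := Real.lt_tan hz h
      rw [Real.tan_eq_sin_div_cos, lt_div_iff₀ hc'] at ht
      linarith
  have hpos : 0 < 1 / (Real.pi - x) := one_div_pos.mpr (by linarith)
  have hpos' : 0 < 1 / x := one_div_pos.mpr h0
  rcases le_total x (Real.pi / 2) with h | h
  · obtain ⟨h1, h2⟩ := key x h0 h
    rw [abs_of_nonneg h1]; linarith
  · obtain ⟨h1, h2⟩ := key (Real.pi - x) (by linarith) (by linarith)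
    have h3 : Real.cot (Real.pi - x) = -Real.cot x := by
      rw [Real.cot_eq_cos_div_sin, Real.cot_eq_cos_div_sin, Real.cos_pi_sub, Real.sin_pi_sub,
        neg_div]
    rw [h3] at h1 h2
    rw [abs_of_nonpos (by linarith)]; linarith

theorem sum_abs_cot_le {n : ℕ} (hn : 0 < n) :
    ∑ m ∈ Finset.range n, |Real.cot ((2 * m + 1) * Real.pi / n / 2)| ≤
      n * (2 / Real.pi * (2 + Real.log n)) := by
  have hn' : (0 : ℝ) < n := by exact_mod_cast hn
  have hterm : ∀ m ∈ Finset.range n, |Real.cot ((2 * (m : ℝ) + 1) * Real.pi / n / 2)| ≤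
      2 * n / Real.pi * (1 / (2 * m + 1)) +
        2 * n / Real.pi * (1 / (2 * (n - 1 - m : ℕ) + 1)) := by
    intro m hm
    have hm' := Finset.mem_range.mp hm
    have hmn : (m : ℝ) + 1 ≤ n := by exact_mod_cast hm'
    refine (abs_cot_le (by positivity) ?_).trans (le_of_eq ?_)
    · rw [div_div, div_lt_iff₀ (by positivity)]
      nlinarith [Real.pi_pos]
    · have hc : ((n - 1 - m : ℕ) : ℝ) = n - 1 - m := by
        rw [Nat.cast_sub (by omega), Nat.cast_sub (by omega)]; simp
      have hd : Real.pi - (2 * (m : ℝ) + 1) * Real.pi / n / 2 =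
          (2 * (n - 1 - m) + 1) * Real.pi / (2 * n) := by field_simp; ring
      have hp : (0 : ℝ) < 2 * (n - 1 - m) + 1 := by linarith
      rw [hc, hd]
      congr 1 <;> field_simp
  refine (Finset.sum_le_sum hterm).trans ?_
  rw [Finset.sum_add_distrib, ← Finset.mul_sum, ← Finset.mul_sum,
    Finset.sum_range_reflect (fun m : ℕ => (1 : ℝ) / (2 * m + 1)) n]
  have h := sum_one_div_odd_le hn
  have hc : 0 ≤ 2 * (n : ℝ) / Real.pi := by positivity
  calc _ = 2 * (2 * n / Real.pi * ∑ m ∈ Finset.range n, (1 : ℝ) / (2 * m + 1)) := by ring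
    _ ≤ 2 * (2 * n / Real.pi * (1 + Real.log n / 2)) := by gcongr
    _ = _ := by ring


/-! ### Quadratic forms in an eigenbasis -/

/-- The coordinate of `x` along the `i`-th vector of an orthonormal eigenbasis of `Q`. -/
noncomputable def eigenCoord {n : ℕ} {Q : Matrix (Fin n) (Fin n) ℝ} (hQ : Q.IsHermitian)
    (i : Fin n) (x : Fin n → ℝ) : ℝ :=
  (hQ.eigenvectorBasis i).ofLp ⬝ᵥ x

section Spectral

variable {n : ℕ} {Q : Matrix (Fin n) (Fin n) ℝ}

theorem dotProduct_mulVec_comm_of_isHermitian (hQ : Q.IsHermitian) (x y : Fin n → ℝ) :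
    x ⬝ᵥ Q *ᵥ y = y ⬝ᵥ Q *ᵥ x := by
  have h : Qᵀ = Q := by rw [← Matrix.conjTranspose_eq_transpose_of_trivial]; exact hQ.eq
  rw [Matrix.dotProduct_mulVec, ← Matrix.mulVec_transpose, h, dotProduct_comm]

theorem dotProduct_eq_sum_eigenCoord (hQ : Q.IsHermitian) (x y : Fin n → ℝ) :
    x ⬝ᵥ y = ∑ i, eigenCoord hQ i x * eigenCoord hQ i y := by
  have h := hQ.eigenvectorBasis.sum_inner_mul_inner (WithLp.toLp 2 x) (WithLp.toLp 2 y)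
  simp only [EuclideanSpace.inner_eq_star_dotProduct, star_trivial] at h
  rw [dotProduct_comm, ← h]
  exact Finset.sum_congr rfl fun i _ => by rw [eigenCoord, eigenCoord, dotProduct_comm y]

theorem eigenCoord_mulVec (hQ : Q.IsHermitian) (i : Fin n) (x : Fin n → ℝ) :
    eigenCoord hQ i (Q *ᵥ x) = hQ.eigenvalues i * eigenCoord hQ i x := by
  rw [eigenCoord, dotProduct_mulVec_comm_of_isHermitian hQ, hQ.mulVec_eigenvectorBasis,
    dotProduct_smul, smul_eq_mul, eigenCoord, dotProduct_comm]

theorem dotProduct_mulVec_eq_sum (hQ : Q.IsHermitian) (x y : Fin n → ℝ) :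
    x ⬝ᵥ Q *ᵥ y = ∑ i, hQ.eigenvalues i * (eigenCoord hQ i x * eigenCoord hQ i y) := by
  rw [dotProduct_eq_sum_eigenCoord hQ]
  exact Finset.sum_congr rfl fun i _ => by rw [eigenCoord_mulVec]; ring

theorem mulVec_dotProduct_mulVec_eq_sum (hQ : Q.IsHermitian) (x : Fin n → ℝ) :
    Q *ᵥ x ⬝ᵥ Q *ᵥ x = ∑ i, hQ.eigenvalues i ^ 2 * eigenCoord hQ i x ^ 2 := by
  rw [dotProduct_eq_sum_eigenCoord hQ]
  exact Finset.sum_congr rfl fun i _ => by rw [eigenCoord_mulVec]; ring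

theorem eigenvalues_le_lamMax (hQ : Q.IsHermitian) (i : Fin n) :
    hQ.eigenvalues i ≤ lamMax Q :=
  le_csSup (Q.finite_real_spectrum.bddAbove) (hQ.eigenvalues_mem_spectrum_real i)

theorem lamMin_le_eigenvalues (hQ : Q.IsHermitian) {i : Fin n} (hi : hQ.eigenvalues i ≠ 0) :
    lamMin Q ≤ hQ.eigenvalues i :=
  csInf_le ((Q.finite_real_spectrum.subset fun _ h => h.1).bddBelow)
    ⟨hQ.eigenvalues_mem_spectrum_real i, hi⟩

theorem lamMin_pos (hQ : Q.PosSemidef) (h0 : Q ≠ 0) : 0 < lamMin Q := by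
  obtain ⟨i, hi⟩ : ∃ i, hQ.1.eigenvalues i ≠ 0 := by
    by_contra! h
    exact h0 (hQ.1.eigenvalues_eq_zero_iff.mp (funext h))
  have hmem : lamMin Q ∈ {μ : ℝ | μ ∈ spectrum ℝ Q ∧ μ ≠ 0} :=
    Set.Nonempty.csInf_mem ⟨_, hQ.1.eigenvalues_mem_spectrum_real i, hi⟩
      (Q.finite_real_spectrum.subset fun _ h => h.1)
  obtain ⟨j, hj⟩ := hQ.1.spectrum_real_eq_range_eigenvalues ▸ hmem.1
  refine lt_of_le_of_ne ?_ hmem.2.symm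
  rw [← hj]
  exact hQ.eigenvalues_nonneg j

theorem lamMin_mul_dotProduct_le (hQ : Q.PosSemidef) (x : Fin n → ℝ) :
    lamMin Q * (x ⬝ᵥ Q *ᵥ x) ≤ Q *ᵥ x ⬝ᵥ Q *ᵥ x := by
  rw [mulVec_dotProduct_mulVec_eq_sum hQ.1, dotProduct_mulVec_eq_sum hQ.1, Finset.mul_sum]
  refine Finset.sum_le_sum fun i _ => ?_
  rcases eq_or_ne (hQ.1.eigenvalues i) 0 with h | h
  · simp [h]
  · have h1 := lamMin_le_eigenvalues hQ.1 h
    have h2 := mul_nonneg (hQ.eigenvalues_nonneg i) (sq_nonneg (eigenCoord hQ.1 i x))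
    nlinarith [mul_le_mul_of_nonneg_right h1 h2]

theorem mulVec_dotProduct_mulVec_le (hQ : Q.PosSemidef) (x : Fin n → ℝ) :
    Q *ᵥ x ⬝ᵥ Q *ᵥ x ≤ lamMax Q * (x ⬝ᵥ Q *ᵥ x) := by
  rw [mulVec_dotProduct_mulVec_eq_sum hQ.1, dotProduct_mulVec_eq_sum hQ.1, Finset.mul_sum]
  refine Finset.sum_le_sum fun i _ => ?_
  have h1 := eigenvalues_le_lamMax hQ.1 i
  have h2 := mul_nonneg (hQ.eigenvalues_nonneg i) (sq_nonneg (eigenCoord hQ.1 i x))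
  nlinarith [mul_le_mul_of_nonneg_right h1 h2]

/-- The spectrum of `Q - L / 2` lies in `[-L / 2, L / 2]`; the operator norm bound `L / 2` is
stated for the bilinear form, in the form that survives sums without square roots. -/
theorem two_mul_dotProduct_centered_le (hQ : Q.PosSemidef) (x y : Fin n → ℝ) :
    2 * (x ⬝ᵥ (Q - (lamMax Q / 2) • 1) *ᵥ y) ≤ lamMax Q / 2 * (x ⬝ᵥ x + y ⬝ᵥ y) := by
  have h : x ⬝ᵥ (Q - (lamMax Q / 2) • 1) *ᵥ y = x ⬝ᵥ Q *ᵥ y - lamMax Q / 2 * (x ⬝ᵥ y) := by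
    rw [Matrix.sub_mulVec, Matrix.smul_mulVec, Matrix.one_mulVec, dotProduct_sub,
      dotProduct_smul, smul_eq_mul]
  rw [h, dotProduct_mulVec_eq_sum hQ.1, dotProduct_eq_sum_eigenCoord hQ.1 x y,
    dotProduct_eq_sum_eigenCoord hQ.1 x x, dotProduct_eq_sum_eigenCoord hQ.1 y y,
    ← Finset.sum_add_distrib, Finset.mul_sum, Finset.mul_sum, ← Finset.sum_sub_distrib,
    Finset.mul_sum]
  refine Finset.sum_le_sum fun i _ => ?_
  have h1 := eigenvalues_le_lamMax hQ.1 i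
  have h2 := hQ.eigenvalues_nonneg i
  nlinarith [mul_nonneg h2 (sq_nonneg (eigenCoord hQ.1 i x - eigenCoord hQ.1 i y)),
    mul_nonneg (sub_nonneg.mpr h1) (sq_nonneg (eigenCoord hQ.1 i x + eigenCoord hQ.1 i y))]

theorem diag_le_lamMax (hQ : Q.PosSemidef) (i : Fin n) : Q i i ≤ lamMax Q := by
  have h := two_mul_dotProduct_centered_le hQ (Pi.single i 1) (Pi.single i 1)
  simp at h
  linarith

theorem sum_sq_le_lamMax_mul_trace (hQ : Q.PosSemidef) :
    ∑ i, ∑ j, Q i j ^ 2 ≤ lamMax Q * ∑ i, Q i i := by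
  rw [Finset.sum_comm, Finset.mul_sum]
  refine Finset.sum_le_sum fun j _ => ?_
  have h := mulVec_dotProduct_mulVec_le hQ (Pi.single j 1)
  rw [single_one_dotProduct] at h
  simpa [dotProduct, sq] using h

/-- If the trace is less than twice the smallest nonzero eigenvalue, then `Q` has rank at most
one, so that its `2 × 2` minors vanish. -/
theorem diag_mul_dotProduct_eq_sq_of_trace_lt (hQ : Q.PosSemidef)
    (h : ∑ i, Q i i < 2 * lamMin Q) (l : Fin n) (x : Fin n → ℝ) :
    Q l l * (x ⬝ᵥ Q *ᵥ x) = (Q *ᵥ x) l ^ 2 := by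
  have htr : ∑ i, hQ.1.eigenvalues i = ∑ i, Q i i := by
    simpa [Matrix.trace] using hQ.1.trace_eq_sum_eigenvalues.symm
  have huniq : ∀ i j, i ≠ j → hQ.1.eigenvalues i ≠ 0 → hQ.1.eigenvalues j = 0 := by
    intro i j hij hi
    by_contra hj
    have h1 := lamMin_le_eigenvalues hQ.1 hi
    have h2 := lamMin_le_eigenvalues hQ.1 hj
    have h3 : ∑ k ∈ ({i, j} : Finset (Fin n)), hQ.1.eigenvalues k ≤
        ∑ k, hQ.1.eigenvalues k :=
      Finset.sum_le_sum_of_subset_of_nonneg (Finset.subset_univ _)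
        fun k _ _ => hQ.eigenvalues_nonneg k
    rw [Finset.sum_pair hij] at h3
    linarith
  have e1 : Q l l = Pi.single l 1 ⬝ᵥ Q *ᵥ Pi.single l 1 := by simp
  have e2 : (Q *ᵥ x) l = Pi.single l 1 ⬝ᵥ Q *ᵥ x := by simp
  rw [e1, e2]
  simp only [dotProduct_mulVec_eq_sum hQ.1]
  by_cases hz : ∃ i, hQ.1.eigenvalues i ≠ 0
  · obtain ⟨i, hi⟩ := hz
    have hs : ∀ F : Fin n → ℝ, ∑ k, hQ.1.eigenvalues k * F k = hQ.1.eigenvalues i * F i :=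
      fun F => Finset.sum_eq_single i
        (fun k _ hk => by rw [huniq i k hk.symm hi, zero_mul]) (by simp)
    rw [hs, hs, hs]
    ring
  · push Not at hz
    simp [hz]

end Spectral

/-! ### Triangular truncation -/

section Truncation

variable {n : ℕ}

/-- The Schur product of `M` with the matrix `sign (p - q)`: the strictly lower part of `M` minus
its strictly upper part. -/
def signPart (M : Matrix (Fin n) (Fin n) ℝ) : Matrix (Fin n) (Fin n) ℝ :=
  Matrix.of fun p q => if q < p then M p q else if p < q then -M p q else 0

/-- A sampled conjugate kernel represents the sign function on `(-n, n)`, which makes the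
Schur multiplier `sign (p - q)` a combination of products with diagonal matrices. -/
theorem signPart_apply_eq_sum (M : Matrix (Fin n) (Fin n) ℝ) (p q : Fin n) :
    n * signPart M p q = ∑ m ∈ Finset.range n, Real.cot ((2 * m + 1) * Real.pi / n / 2) *
      (Real.sin (p * ((2 * m + 1) * Real.pi / n)) * M p q *
          Real.cos (q * ((2 * m + 1) * Real.pi / n)) -
        Real.cos (p * ((2 * m + 1) * Real.pi / n)) * M p q *
          Real.sin (q * ((2 * m + 1) * Real.pi / n))) := by
  have hsum : ∀ a b : Fin n, b < a → ∑ m ∈ Finset.range n,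
      Real.cot ((2 * m + 1) * Real.pi / n / 2) *
        (Real.sin (a * ((2 * m + 1) * Real.pi / n)) * Real.cos (b * ((2 * m + 1) * Real.pi / n)) -
          Real.cos (a * ((2 * m + 1) * Real.pi / n)) *
            Real.sin (b * ((2 * m + 1) * Real.pi / n))) = n := by
    intro a b hab
    have hab' : (b : ℕ) < a := hab
    refine Eq.trans ?_ (sum_cot_mul_sin_eq (n := n) (k := a - b) (by omega) (by omega))
    refine Finset.sum_congr rfl fun m _ => ?_
    rw [← Real.sin_sub, Nat.cast_sub hab'.le, sub_mul]
  rcases lt_trichotomy q p with h | h | h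
  · rw [signPart, Matrix.of_apply, if_pos h]
    refine (congrArg (· * M p q) (hsum p q h)).symm.trans ?_
    simp only [Finset.sum_mul]
    exact Finset.sum_congr rfl fun m _ => by ring
  · subst h
    simp only [signPart, Matrix.of_apply, lt_irrefl, if_false, mul_zero]
    exact (Finset.sum_eq_zero fun m _ => by ring).symm
  · rw [signPart, Matrix.of_apply, if_neg h.not_gt, if_pos h]
    refine (congrArg (· * -M p q) (hsum q p h)).symm.trans ?_
    simp only [Finset.sum_mul]
    exact Finset.sum_congr rfl fun m _ => by ring

/-- Schur multiplication by `sign (p - q)` has operator norm at most `(2 / π) (2 + log n)`. -/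
theorem two_mul_dotProduct_signPart_le (hn : 0 < n) {M : Matrix (Fin n) (Fin n) ℝ} {μ : ℝ}
    (hM : ∀ x y, 2 * (x ⬝ᵥ M *ᵥ y) ≤ μ * (x ⬝ᵥ x + y ⬝ᵥ y)) (hμ : 0 ≤ μ) (x y : Fin n → ℝ) :
    2 * (x ⬝ᵥ signPart M *ᵥ y) ≤
      2 / Real.pi * (2 + Real.log n) * μ * (x ⬝ᵥ x + y ⬝ᵥ y) := by
  have hn' : (0 : ℝ) < n := by exact_mod_cast hn
  let t : ℕ → ℝ := fun m => (2 * m + 1) * Real.pi / n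
  let s : ℕ → (Fin n → ℝ) → Fin n → ℝ := fun m z p => Real.sin (p * t m) * z p
  let c : ℕ → (Fin n → ℝ) → Fin n → ℝ := fun m z p => Real.cos (p * t m) * z p
  have hneg : ∀ x y, -(2 * (x ⬝ᵥ M *ᵥ y)) ≤ μ * (x ⬝ᵥ x + y ⬝ᵥ y) := by
    intro x y
    have h := hM (-x) y
    simp only [neg_dotProduct, dotProduct_neg, neg_neg] at h
    linarith
  have hsc : ∀ m z, s m z ⬝ᵥ s m z + c m z ⬝ᵥ c m z = z ⬝ᵥ z := by
    intro m z
    simp only [s, c, dotProduct, ← Finset.sum_add_distrib]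
    refine Finset.sum_congr rfl fun p _ => ?_
    linear_combination (z p * z p) * Real.sin_sq_add_cos_sq (p * t m)
  have hexp : n * (x ⬝ᵥ signPart M *ᵥ y) = ∑ m ∈ Finset.range n, Real.cot (t m / 2) *
      (s m x ⬝ᵥ M *ᵥ c m y - c m x ⬝ᵥ M *ᵥ s m y) := by
    simp only [dotProduct, Matrix.mulVec, Finset.mul_sum, ← Finset.sum_sub_distrib]
    refine Eq.trans ?_ Finset.sum_comm
    refine Finset.sum_congr rfl fun p _ => ?_
    refine Eq.trans ?_ Finset.sum_comm
    refine Finset.sum_congr rfl fun q _ => ?_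
    calc (n : ℝ) * (x p * (signPart M p q * y q)) = (n * signPart M p q) * (x p * y q) := by ring
      _ = _ := by
        rw [signPart_apply_eq_sum, Finset.sum_mul]
        exact Finset.sum_congr rfl fun m _ => by simp only [s, c, t]; ring
  have hterm : ∀ m ∈ Finset.range n, 2 * (Real.cot (t m / 2) *
      (s m x ⬝ᵥ M *ᵥ c m y - c m x ⬝ᵥ M *ᵥ s m y)) ≤
      |Real.cot (t m / 2)| * (μ * (x ⬝ᵥ x + y ⬝ᵥ y)) := by
    intro m _
    have h1 := hM (s m x) (c m y)
    have h2 := hM (c m x) (s m y)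
    have h3 := hneg (s m x) (c m y)
    have h4 := hneg (c m x) (s m y)
    rw [← hsc m x, ← hsc m y]
    refine (le_abs_self _).trans ?_
    rw [mul_left_comm, abs_mul]
    refine mul_le_mul_of_nonneg_left (abs_le.mpr ⟨?_, ?_⟩) (abs_nonneg _) <;> linarith
  have hxy : 0 ≤ μ * (x ⬝ᵥ x + y ⬝ᵥ y) :=
    mul_nonneg hμ (add_nonneg (Finset.sum_nonneg fun _ _ => mul_self_nonneg _)
      (Finset.sum_nonneg fun _ _ => mul_self_nonneg _))
  have hmain : n * (2 * (x ⬝ᵥ signPart M *ᵥ y)) ≤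
      n * (2 / Real.pi * (2 + Real.log n) * μ * (x ⬝ᵥ x + y ⬝ᵥ y)) := by
    calc n * (2 * (x ⬝ᵥ signPart M *ᵥ y)) = 2 * (n * (x ⬝ᵥ signPart M *ᵥ y)) := by ring
      _ ≤ (∑ m ∈ Finset.range n, |Real.cot (t m / 2)|) * (μ * (x ⬝ᵥ x + y ⬝ᵥ y)) := by
        rw [hexp, Finset.mul_sum, Finset.sum_mul]
        exact Finset.sum_le_sum hterm
      _ ≤ (n * (2 / Real.pi * (2 + Real.log n))) * (μ * (x ⬝ᵥ x + y ⬝ᵥ y)) :=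
        mul_le_mul_of_nonneg_right (sum_abs_cot_le hn) hxy
      _ = _ := by ring
  exact le_of_mul_le_mul_left hmain hn'

/-- The strictly upper triangular part of a matrix. -/
def strictUpper (Q : Matrix (Fin n) (Fin n) ℝ) : Matrix (Fin n) (Fin n) ℝ :=
  Matrix.of fun i j => if i < j then Q i j else 0

/-- Centring `Q` and its diagonal at `L / 2` does not change the off-diagonal entries, and halves
the norm of the matrix to be truncated. -/
theorem two_smul_strictUpper_eq (Q : Matrix (Fin n) (Fin n) ℝ) (a : ℝ) :
    (2 : ℝ) • strictUpper Q =
      (Q - a • 1) - (Matrix.diagonal Q.diag - a • 1) - signPart (Q - a • 1) := by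
  ext i j
  rcases lt_trichotomy i j with h | h | h
  · simp [strictUpper, signPart, h, h.not_gt, Matrix.one_apply, h.ne, two_mul]
  · subst h
    simp [strictUpper, signPart]
  · simp [strictUpper, signPart, h, h.not_gt, Matrix.one_apply, h.ne']

theorem strictUpper_mulVec_sq_le_of_log {Q : Matrix (Fin n) (Fin n) ℝ} (hn : 0 < n)
    (hQ : Q.PosSemidef) (hL : 0 < lamMax Q) (v : Fin n → ℝ) :
    strictUpper Q *ᵥ v ⬝ᵥ strictUpper Q *ᵥ v ≤
      (lamMax Q / 2 * (1 + 1 / Real.pi * (2 + Real.log n))) ^ 2 * (v ⬝ᵥ v) := by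
  set a := lamMax Q / 2 with ha
  have ha0 : 0 < a := by positivity
  set κ : ℝ := a * (1 + 1 / Real.pi * (2 + Real.log n)) with hκ
  have hκ0 : 0 < κ := by
    have := Real.log_natCast_nonneg n
    positivity
  have hdiag : ∀ x y : Fin n → ℝ,
      -(2 * (x ⬝ᵥ (Matrix.diagonal Q.diag - a • 1) *ᵥ y)) ≤ a * (x ⬝ᵥ x + y ⬝ᵥ y) := by
    intro x y
    simp only [dotProduct, Matrix.sub_mulVec, Matrix.mulVec_diagonal, Matrix.smul_mulVec,
      Matrix.one_mulVec, Pi.sub_apply, Pi.smul_apply, smul_eq_mul, Matrix.diag_apply,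
      ← Finset.sum_add_distrib, Finset.mul_sum, ← Finset.sum_neg_distrib]
    refine Finset.sum_le_sum fun i _ => ?_
    have h1 := diag_le_lamMax hQ i
    have h2 : 0 ≤ Q i i := hQ.diag_nonneg
    have h3 : Q i i ≤ 2 * a := by rw [ha]; linarith
    nlinarith [mul_nonneg h2 (sq_nonneg (x i + y i)),
      mul_nonneg (sub_nonneg.mpr h3) (sq_nonneg (x i - y i))]
  have hform : ∀ x y : Fin n → ℝ,
      2 * (x ⬝ᵥ strictUpper Q *ᵥ y) ≤ κ * (x ⬝ᵥ x + y ⬝ᵥ y) := by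
    intro x y
    have h1 := two_mul_dotProduct_centered_le hQ x y
    have h2 := hdiag x y
    have h3 := two_mul_dotProduct_signPart_le hn (two_mul_dotProduct_centered_le hQ) ha0.le (-x) y
    have h4 := congrArg (fun N => x ⬝ᵥ N *ᵥ y) (two_smul_strictUpper_eq Q a)
    simp only [Matrix.sub_mulVec _ (signPart _), Matrix.sub_mulVec (Q - a • 1),
      Matrix.smul_mulVec (2 : ℝ), dotProduct_sub, dotProduct_smul, smul_eq_mul] at h4
    simp only [neg_dotProduct, dotProduct_neg, neg_neg] at h3
    rw [← ha] at h1 h3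
    have h5 : κ * (x ⬝ᵥ x + y ⬝ᵥ y) = (a * (x ⬝ᵥ x + y ⬝ᵥ y) + a * (x ⬝ᵥ x + y ⬝ᵥ y) +
        2 / Real.pi * (2 + Real.log n) * a * (x ⬝ᵥ x + y ⬝ᵥ y)) / 2 := by rw [hκ]; ring
    linarith
  -- the optimal test vector for the bilinear bound is `κ⁻¹ U v`
  have h := hform (κ⁻¹ • (strictUpper Q *ᵥ v)) v
  simp only [smul_dotProduct, dotProduct_smul, smul_eq_mul] at h
  set S := strictUpper Q *ᵥ v ⬝ᵥ strictUpper Q *ᵥ v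
  have h' : κ * (2 * (κ⁻¹ * S)) ≤ κ * (κ * (κ⁻¹ * (κ⁻¹ * S) + v ⬝ᵥ v)) :=
    mul_le_mul_of_nonneg_left h hκ0.le
  have e1 : κ * (2 * (κ⁻¹ * S)) = 2 * S := by field_simp
  have e2 : κ * (κ * (κ⁻¹ * (κ⁻¹ * S) + v ⬝ᵥ v)) = S + κ ^ 2 * (v ⬝ᵥ v) := by field_simp
  rw [e1, e2] at h'
  linarith

theorem two_mul_sum_strictUpper_sq {Q : Matrix (Fin n) (Fin n) ℝ} (hQ : Q.IsHermitian) :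
    2 * ∑ i, ∑ j, strictUpper Q i j ^ 2 = ∑ i, ∑ j, Q i j ^ 2 - ∑ i, Q i i ^ 2 := by
  have hsymm : ∀ i j, Q i j = Q j i := fun i j => by simpa using (hQ.apply i j).symm
  have h1 : ∑ i, Q i i ^ 2 = ∑ i, ∑ j, if i = j then Q i j ^ 2 else 0 := by simp
  have h2 : ∑ i, ∑ j, strictUpper Q i j ^ 2 = ∑ i, ∑ j, strictUpper Q j i ^ 2 :=
    Finset.sum_comm
  rw [two_mul]
  nth_rewrite 2 [h2]
  rw [h1]
  simp only [← Finset.sum_add_distrib, ← Finset.sum_sub_distrib]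
  refine Finset.sum_congr rfl fun i _ => Finset.sum_congr rfl fun j _ => ?_
  rcases lt_trichotomy i j with h | h | h
  · simp [strictUpper, h, h.not_gt, h.ne]
  · subst h
    simp [strictUpper]
  · simp [strictUpper, h, h.not_gt, h.ne', hsymm j i]

theorem mulVec_sq_le_sum_sq (M : Matrix (Fin n) (Fin n) ℝ) (v : Fin n → ℝ) :
    M *ᵥ v ⬝ᵥ M *ᵥ v ≤ (∑ i, ∑ j, M i j ^ 2) * (v ⬝ᵥ v) := by
  rw [Finset.sum_mul]
  refine Finset.sum_le_sum fun i _ => ?_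
  have h := Finset.sum_mul_sq_le_sq_mul_sq Finset.univ (M i) v
  simpa [dotProduct, Matrix.mulVec, sq] using h

end Truncation

/-! ### The objective and the coordinate descent sweep -/

section Objective

variable {n : ℕ}

theorem gram_posSemidef (A : Matrix (Fin n) (Fin n) ℝ) : (gram A).PosSemidef := by
  have h := Matrix.posSemidef_conjTranspose_mul_self A
  rwa [Matrix.conjTranspose_eq_transpose_of_trivial] at h

theorem objective_mulVec (A : Matrix (Fin n) (Fin n) ℝ) (z x : Fin n → ℝ) :
    objective A (A *ᵥ z) x = 1 / 2 * ((x - z) ⬝ᵥ gram A *ᵥ (x - z)) := by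
  rw [objective, ← Matrix.mulVec_sub, EuclideanSpace.real_norm_sq_eq, gram,
    ← Matrix.mulVec_mulVec, Matrix.dotProduct_mulVec, Matrix.vecMul_transpose]
  simp [dotProduct, sq]

theorem optValue_mulVec (A : Matrix (Fin n) (Fin n) ℝ) (z : Fin n → ℝ) :
    optValue A (A *ᵥ z) = 0 := by
  have h0 : ∀ x, 0 ≤ objective A (A *ᵥ z) x := fun x => by unfold objective; positivity
  refine le_antisymm ?_ (le_ciInf h0)
  refine (ciInf_le ⟨0, by rintro _ ⟨x, rfl⟩; exact h0 x⟩ z).trans (le_of_eq ?_)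
  simp [objective]

theorem dotProduct_mulVec_add {Q : Matrix (Fin n) (Fin n) ℝ} (hQ : Q.IsHermitian)
    (x y : Fin n → ℝ) :
    (x + y) ⬝ᵥ Q *ᵥ (x + y) = x ⬝ᵥ Q *ᵥ x + 2 * (y ⬝ᵥ Q *ᵥ x) + y ⬝ᵥ Q *ᵥ y := by
  simp only [Matrix.mulVec_add, add_dotProduct, dotProduct_add]
  rw [dotProduct_mulVec_comm_of_isHermitian hQ x y]
  ring

theorem lowerPart_add_strictUpper (Q : Matrix (Fin n) (Fin n) ℝ) :
    lowerPart Q + strictUpper Q = Q := by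
  ext i j
  rcases le_or_gt j i with h | h
  · simp [lowerPart, strictUpper, h, h.not_gt]
  · simp [lowerPart, strictUpper, h, h.not_ge]

theorem mulVec_sub_eq_neg_strictUpper_mulVec {Q : Matrix (Fin n) (Fin n) ℝ} {e v : Fin n → ℝ}
    (hv : lowerPart Q *ᵥ v = Q *ᵥ e) : Q *ᵥ (e - v) = -(strictUpper Q *ᵥ v) := by
  rw [Matrix.mulVec_sub, ← hv]
  nth_rewrite 2 [← lowerPart_add_strictUpper Q]
  rw [Matrix.add_mulVec]
  abel

theorem transpose_lowerPart {Q : Matrix (Fin n) (Fin n) ℝ} (hQ : Q.IsHermitian) :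
    (lowerPart Q)ᵀ = Matrix.diagonal Q.diag + strictUpper Q := by
  have hsymm : ∀ i j, Q i j = Q j i := fun i j => by simpa using (hQ.apply i j).symm
  ext i j
  rcases lt_trichotomy i j with h | h | h
  · simp [lowerPart, strictUpper, h, h.le, h.ne, hsymm j i]
  · subst h
    simp [lowerPart, strictUpper]
  · simp [lowerPart, strictUpper, h.not_gt, h.ne', h.not_ge]

theorem dotProduct_mulVec_eq_diag_add {Q : Matrix (Fin n) (Fin n) ℝ} (hQ : Q.IsHermitian)
    (v : Fin n → ℝ) :
    v ⬝ᵥ Q *ᵥ v = v ⬝ᵥ Matrix.diagonal Q.diag *ᵥ v + 2 * (v ⬝ᵥ strictUpper Q *ᵥ v) := by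
  have h1 : v ⬝ᵥ lowerPart Q *ᵥ v = v ⬝ᵥ (lowerPart Q)ᵀ *ᵥ v := by
    rw [Matrix.mulVec_transpose, Matrix.dotProduct_mulVec, dotProduct_comm]
  rw [transpose_lowerPart hQ, Matrix.add_mulVec, dotProduct_add] at h1
  nth_rewrite 1 [← lowerPart_add_strictUpper Q]
  rw [Matrix.add_mulVec, dotProduct_add, h1]
  ring

theorem isUnit_det_lowerPart {Q : Matrix (Fin n) (Fin n) ℝ} (h : ∀ i, Q i i ≠ 0) :
    IsUnit (lowerPart Q).det := by
  have htri : (lowerPart Q).BlockTriangular OrderDual.toDual := fun i j hij => by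
    have hij' : i < j := hij
    simp [lowerPart, hij'.not_ge]
  rw [Matrix.det_of_isLowerTriangular _ htri, isUnit_iff_ne_zero, Finset.prod_ne_zero_iff]
  intro i _
  simpa [lowerPart] using h i

/-- The optimality conditions of one epoch of coordinate descent, in matrix form. -/
theorem IsPrediction.lowerPart_mulVec_sub {A : Matrix (Fin n) (Fin n) ℝ} {x y z : Fin n → ℝ}
    (hA : ∀ i, gram A i i ≠ 0) (h : IsPrediction A (A *ᵥ z) x y) :
    lowerPart (gram A) *ᵥ (x - y) = gram A *ᵥ (x - z) := by
  have hQ := gram_posSemidef A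
  set Q := gram A with hQdef
  ext i
  have hq : 0 < Q i i := lt_of_le_of_ne hQ.diag_nonneg (hA i).symm
  set p := sweepPoint x y i (y i) with hp
  have hstat : (Q *ᵥ (p - z)) i = 0 := by
    set g := (Q *ᵥ (p - z)) i with hg
    -- the Newton step for the one-dimensional quadratic
    have hmin := h i (Set.mem_univ (y i - g / Q i i))
    have hmove : sweepPoint x y i (y i - g / Q i i) - z =
        (p - z) + (-(g / Q i i)) • Pi.single i 1 := by
      ext j
      rcases lt_trichotomy j i with hj | hj | hj
      · simp [hp, sweepPoint, hj, hj.ne]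
      · subst hj
        simp [hp, sweepPoint]
        ring
      · simp [hp, sweepPoint, hj.not_gt, hj.ne']
    simp only [Set.mem_ofPred_eq, objective_mulVec] at hmin
    rw [hmove, dotProduct_mulVec_add hQ.1, ← hp, ← hQdef] at hmin
    simp only [smul_dotProduct, Matrix.mulVec_smul, dotProduct_smul, single_one_dotProduct,
      Matrix.mulVec_single_one, Matrix.col_apply, smul_eq_mul, ← hg] at hmin
    have h1 : g / Q i i * g = g / Q i i * (g / Q i i * Q i i) := by field_simp
    have h2 : g / Q i i * g = g ^ 2 / Q i i := by ring
    have h3 : g ^ 2 / Q i i ≤ 0 := by linarith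
    have h4 : 0 ≤ g ^ 2 / Q i i := by positivity
    have h5 : g ^ 2 / Q i i = 0 := le_antisymm h3 h4
    simpa [hq.ne'] using h5
  have hlow : (lowerPart Q *ᵥ (x - y)) i = (Q *ᵥ (x - p)) i := by
    change _ ⬝ᵥ _ = _ ⬝ᵥ _
    refine Finset.sum_congr rfl fun j _ => ?_
    rcases lt_trichotomy j i with hj | hj | hj
    · simp [hp, lowerPart, sweepPoint, hj, hj.le]
    · subst hj
      simp [hp, lowerPart, sweepPoint]
    · simp [hp, lowerPart, sweepPoint, hj.not_gt, hj.not_ge, hj.ne']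
  have hsplit : x - z = (x - p) + (p - z) := by abel
  rw [hlow, hsplit, Matrix.mulVec_add, Pi.add_apply, hstat, add_zero]

end Objective

/-! ### Gaussian back substitution -/

section Correction

variable {n : ℕ} [NeZero n]

theorem borderFirst_mulVec_zero (M : Matrix (Fin n) (Fin n) ℝ) (v : Fin n → ℝ) :
    (borderFirst M *ᵥ v) 0 = v 0 := by
  simp [Matrix.mulVec, dotProduct, borderFirst]

theorem borderFirst_mulVec_of_ne_zero (M : Matrix (Fin n) (Fin n) ℝ) (v : Fin n → ℝ)
    {i : Fin n} (hi : i ≠ 0) :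
    (borderFirst M *ᵥ v) i = (M *ᵥ Function.update v 0 0) i := by
  change _ ⬝ᵥ _ = _ ⬝ᵥ _
  refine Finset.sum_congr rfl fun j _ => ?_
  by_cases hj : j = 0
  · subst hj
    simp [borderFirst, hi]
  · simp [borderFirst, hi, hj]

theorem correction_mulVec_zero (Q : Matrix (Fin n) (Fin n) ℝ) (v : Fin n → ℝ) :
    (correction Q *ᵥ v) 0 = v 0 := by
  rw [correction, ← Matrix.mulVec_mulVec, borderFirst_mulVec_zero, borderFirst_mulVec_zero]

/-- The corrected step solves the rows `2, …, n` of the upper triangular system `Γᵀ w = D v` by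
back substitution; these rows do not involve the first unknown. -/
theorem transpose_lowerPart_mulVec_correction {Q : Matrix (Fin n) (Fin n) ℝ}
    (hQ : ∀ i, Q i i ≠ 0) (v : Fin n → ℝ) {i : Fin n} (hi : i ≠ 0) :
    ((lowerPart Q)ᵀ *ᵥ (correction Q *ᵥ v)) i = Q i i * v i := by
  set u := borderFirst (Matrix.diagonal Q.diag) *ᵥ v with hu
  set u' := Function.update u 0 0 with hu'
  have hrow : ((lowerPart Q)ᵀ *ᵥ (correction Q *ᵥ v)) i =
      ((lowerPart Q)ᵀ *ᵥ (((lowerPart Q)⁻¹)ᵀ *ᵥ u')) i := by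
    change _ ⬝ᵥ _ = _ ⬝ᵥ _
    refine Finset.sum_congr rfl fun j _ => ?_
    by_cases hj : j = 0
    · subst hj
      simp [lowerPart, hi]
    · rw [correction, ← Matrix.mulVec_mulVec, borderFirst_mulVec_of_ne_zero _ _ hj]
  rw [hrow, Matrix.mulVec_mulVec, ← Matrix.transpose_mul,
    Matrix.nonsing_inv_mul _ (isUnit_det_lowerPart hQ), Matrix.transpose_one, Matrix.one_mulVec,
    hu', Function.update_of_ne hi, hu, borderFirst_mulVec_of_ne_zero _ _ hi,
    Matrix.mulVec_diagonal, Function.update_of_ne hi, Matrix.diag_apply]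

/-- The correction step does not increase the objective: it is a backward sweep over the
coordinates `n, …, 2`, and decreases the quadratic form by `dᵀ D d` with `d` the displacement. -/
theorem dotProduct_mulVec_correction_le {Q : Matrix (Fin n) (Fin n) ℝ} (hQ : Q.PosSemidef)
    (h0 : ∀ i, Q i i ≠ 0) {e v : Fin n → ℝ} (hv : lowerPart Q *ᵥ v = Q *ᵥ e) :
    (e - correction Q *ᵥ v) ⬝ᵥ Q *ᵥ (e - correction Q *ᵥ v) ≤ (e - v) ⬝ᵥ Q *ᵥ (e - v) := by
  set w := correction Q *ᵥ v with hw
  set d := v - w with hd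
  have hd0 : d 0 = 0 := by simp [hd, hw, correction_mulVec_zero]
  have hres := mulVec_sub_eq_neg_strictUpper_mulVec hv
  have hrow : d ⬝ᵥ strictUpper Q *ᵥ v =
      d ⬝ᵥ (Matrix.diagonal Q.diag *ᵥ d + strictUpper Q *ᵥ d) := by
    refine Finset.sum_congr rfl fun i _ => ?_
    by_cases hi : i = 0
    · rw [hi, hd0, zero_mul, zero_mul]
    · have h := transpose_lowerPart_mulVec_correction h0 v hi
      rw [transpose_lowerPart hQ.1, ← hw, Matrix.add_mulVec, Pi.add_apply,
        Matrix.mulVec_diagonal] at h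
      simp only [hd, Matrix.mulVec_sub, Pi.add_apply, Pi.sub_apply, Matrix.mulVec_diagonal]
      simp only [Matrix.diag_apply] at h ⊢
      congr 1
      linarith
  have hdd : 0 ≤ d ⬝ᵥ Matrix.diagonal Q.diag *ᵥ d := by
    refine Finset.sum_nonneg fun i _ => ?_
    have h2 : 0 ≤ Q i i := hQ.diag_nonneg
    rw [Matrix.mulVec_diagonal, Matrix.diag_apply]
    nlinarith [mul_nonneg h2 (mul_self_nonneg (d i))]
  have hsplit : e - w = (e - v) + d := by rw [hd]; abel
  rw [hsplit, dotProduct_mulVec_add hQ.1, hres, dotProduct_neg d, hrow,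
    dotProduct_mulVec_eq_diag_add hQ.1 d, dotProduct_add]
  linarith

end Correction

/-! ### Contraction of one epoch -/

section Rate

variable {n : ℕ} {Q : Matrix (Fin n) (Fin n) ℝ}

theorem dotProduct_mulVec_sub_eq (hQ : Q.IsHermitian) {e v : Fin n → ℝ}
    (hv : lowerPart Q *ᵥ v = Q *ᵥ e) :
    (e - v) ⬝ᵥ Q *ᵥ (e - v) = e ⬝ᵥ Q *ᵥ e - v ⬝ᵥ Matrix.diagonal Q.diag *ᵥ v := by
  have h1 : v ⬝ᵥ Q *ᵥ v = v ⬝ᵥ Q *ᵥ e + v ⬝ᵥ strictUpper Q *ᵥ v := by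
    nth_rewrite 1 [← lowerPart_add_strictUpper Q]
    rw [Matrix.add_mulVec, dotProduct_add, hv]
  have h2 := dotProduct_mulVec_eq_diag_add hQ v
  rw [sub_eq_add_neg, dotProduct_mulVec_add hQ]
  simp only [Matrix.mulVec_neg, neg_dotProduct, dotProduct_neg, neg_neg]
  linarith

theorem diagMin_le (Q : Matrix (Fin n) (Fin n) ℝ) (i : Fin n) : diagMin Q ≤ Q i i :=
  ciInf_le (Set.finite_range _).bddBelow i

theorem diagMin_mul_dotProduct_le (Q : Matrix (Fin n) (Fin n) ℝ) (v : Fin n → ℝ) :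
    diagMin Q * (v ⬝ᵥ v) ≤ v ⬝ᵥ Matrix.diagonal Q.diag *ᵥ v := by
  rw [dotProduct, Finset.mul_sum]
  refine Finset.sum_le_sum fun i _ => ?_
  rw [Matrix.mulVec_diagonal, Matrix.diag_apply]
  nlinarith [mul_le_mul_of_nonneg_right (diagMin_le Q i) (mul_self_nonneg (v i))]

/-- A bound `‖U‖² ≤ N` on the strictly upper part of `Q` bounds the initial gap by the decrease
achieved in one sweep. The gap equals `vᵀ D v + pᵀ Q p` with `p = v - e` and `Q p = U v`. -/
theorem lamMin_mul_dotProduct_le_of_strictUpper (hQ : Q.PosSemidef) (hmin : 0 ≤ diagMin Q)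
    {N : ℝ} {e v : Fin n → ℝ} (hv : lowerPart Q *ᵥ v = Q *ᵥ e)
    (hN : strictUpper Q *ᵥ v ⬝ᵥ strictUpper Q *ᵥ v ≤ N * (v ⬝ᵥ v)) (hN0 : 0 ≤ N) :
    diagMin Q * lamMin Q * (e ⬝ᵥ Q *ᵥ e) ≤
      (diagMin Q * lamMin Q + N) * (v ⬝ᵥ Matrix.diagonal Q.diag *ᵥ v) := by
  have hres := mulVec_sub_eq_neg_strictUpper_mulVec hv
  have h1 := lamMin_mul_dotProduct_le hQ (e - v)
  rw [hres, neg_dotProduct_neg, ← hres, dotProduct_mulVec_sub_eq hQ.1 hv] at h1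
  have h2 := mul_le_mul_of_nonneg_left (h1.trans hN) hmin
  have h3 := mul_le_mul_of_nonneg_left (diagMin_mul_dotProduct_le Q v) hN0
  linarith

/-- If `Q` has rank one, a single sweep already reaches the minimum: the last entry of the
residual `-U v` vanishes, and the residual is determined by it. -/
theorem dotProduct_mulVec_sub_eq_zero_of_trace_lt [NeZero n] (hQ : Q.PosSemidef)
    (h0 : ∀ i, Q i i ≠ 0) (htr : ∑ i, Q i i < 2 * lamMin Q) {e v : Fin n → ℝ}
    (hv : lowerPart Q *ᵥ v = Q *ᵥ e) :
    (e - v) ⬝ᵥ Q *ᵥ (e - v) = 0 := by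
  let l : Fin n := ⟨n - 1, by have := NeZero.pos n; omega⟩
  have hl : (Q *ᵥ (e - v)) l = 0 := by
    rw [Matrix.mulVec_sub, ← hv, Pi.sub_apply, sub_eq_zero]
    change _ ⬝ᵥ _ = _ ⬝ᵥ _
    refine Finset.sum_congr rfl fun j _ => ?_
    have hj : j ≤ l := by
      have := j.isLt
      change (j : ℕ) ≤ n - 1
      omega
    simp [lowerPart, hj]
  have h := diag_mul_dotProduct_eq_sq_of_trace_lt hQ htr l (e - v)
  rw [hl] at h
  simpa [h0 l] using h

/-- The Frobenius norm of the strictly upper part is controlled by the trace, because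
`2 ‖U‖² = ‖Q‖² - ∑ Q_ii²` and `‖Q‖² ≤ L ∑ Q_ii`; the diagonal term left over absorbs
`2 L_min λ_min`. -/
theorem two_mul_add_le_lamMax_mul_trace (hQ : Q.PosSemidef) (hmin : 0 ≤ diagMin Q)
    (htr : 2 * lamMin Q ≤ ∑ i, Q i i) :
    2 * (diagMin Q * lamMin Q + ∑ i, ∑ j, strictUpper Q i j ^ 2) ≤
      lamMax Q * ∑ i, Q i i := by
  have h1 := two_mul_sum_strictUpper_sq hQ.1
  have h2 := sum_sq_le_lamMax_mul_trace hQ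
  have h3 : diagMin Q * ∑ i, Q i i ≤ ∑ i, Q i i ^ 2 := by
    rw [Finset.mul_sum]
    refine Finset.sum_le_sum fun i _ => ?_
    have h4 : 0 ≤ Q i i := hQ.diag_nonneg
    nlinarith [mul_le_mul_of_nonneg_right (diagMin_le Q i) h4]
  have h5 := mul_le_mul_of_nonneg_left htr hmin
  linarith

/-- The strictly upper part has norm at most `L (1/2 + 1/π + log n / (2 π))`. The halving gained by
centring `Q` at `L / 2` is what makes room for the factor `2` here. -/
theorem two_mul_add_le_log_sq_mul_lamMax_sq [NeZero n] (hQ : Q.PosSemidef)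
    (hmin : 0 ≤ diagMin Q) (hpos : 0 < lamMin Q)
    (hle : lamMin Q ≤ lamMax Q) :
    2 * (diagMin Q * lamMin Q +
      (lamMax Q / 2 * (1 + 1 / Real.pi * (2 + Real.log n))) ^ 2) ≤
      lamMax Q * ((2 + 1 / Real.pi * Real.log n) ^ 2 * lamMax Q) := by
  have h1 : diagMin Q ≤ lamMax Q := (diagMin_le Q 0).trans (diag_le_lamMax hQ 0)
  have h2 : diagMin Q * lamMin Q ≤ lamMax Q ^ 2 := by
    rw [sq]; exact mul_le_mul h1 hle hpos.le (hmin.trans h1)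
  have h3 : 1 / Real.pi ≤ 1 / 3 := one_div_le_one_div_of_le (by norm_num) Real.pi_gt_three.le
  have h4 : 0 ≤ 1 / Real.pi * Real.log n :=
    mul_nonneg (one_div_pos.mpr Real.pi_pos).le (Real.log_natCast_nonneg n)
  have h5 : 0 < 1 / Real.pi := one_div_pos.mpr Real.pi_pos
  set s := 1 / Real.pi * Real.log n with hs
  have h6 : 1 + 1 / Real.pi * (2 + Real.log n) = 1 + 2 * (1 / Real.pi) + s := by rw [hs]; ring
  have h7 : 2 + 1 / 2 * (1 + 2 * (1 / Real.pi) + s) ^ 2 ≤ (2 + s) ^ 2 := by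
    have h8 : (1 + 2 * (1 / Real.pi) + s) ^ 2 ≤ (5 / 3 + s) ^ 2 :=
      pow_le_pow_left₀ (by positivity) (by linarith) 2
    nlinarith
  rw [h6]
  nlinarith [mul_le_mul_of_nonneg_right h7 (sq_nonneg (lamMax Q))]

/-- With `ρ = L_min / complexity`, one sweep of coordinate descent reaches the minimum or decreases
`eᵀ Q e`, twice the gap, by at least the fraction `2 ρ`. -/
theorem two_mul_div_complexity_mul_le [NeZero n] (hQ : Q.PosSemidef) (h0 : ∀ i, Q i i ≠ 0)
    {e v : Fin n → ℝ} (hv : lowerPart Q *ᵥ v = Q *ᵥ e) :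
    0 < complexity Q ∧ ((e - v) ⬝ᵥ Q *ᵥ (e - v) = 0 ∨
      2 * (diagMin Q / complexity Q) * (e ⬝ᵥ Q *ᵥ e) ≤
        v ⬝ᵥ Matrix.diagonal Q.diag *ᵥ v) := by
  have hdiag : ∀ i, 0 < Q i i := fun i => lt_of_le_of_ne hQ.diag_nonneg (h0 i).symm
  have hmin : 0 ≤ diagMin Q := le_ciInf fun i => (hdiag i).le
  have hpos : 0 < lamMin Q := lamMin_pos hQ fun h => h0 0 (by simp [h])
  have hLpos : 0 < lamMax Q := (hdiag 0).trans_le (diag_le_lamMax hQ 0)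
  have hle : lamMin Q ≤ lamMax Q := by
    obtain ⟨i, hi⟩ : ∃ i, hQ.1.eigenvalues i ≠ 0 := by
      by_contra! h
      exact h0 0 (by simp [hQ.1.eigenvalues_eq_zero_iff.mp (funext h)])
    exact (lamMin_le_eigenvalues hQ.1 hi).trans (eigenvalues_le_lamMax hQ.1 i)
  have hlog : 0 ≤ 1 / Real.pi * Real.log n :=
    mul_nonneg (one_div_pos.mpr Real.pi_pos).le (Real.log_natCast_nonneg n)
  have htrpos : 0 < ∑ i, Q i i := Finset.sum_pos (fun i _ => hdiag i) ⟨0, Finset.mem_univ 0⟩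
  set m := min (∑ i, Q i i) ((2 + 1 / Real.pi * Real.log n) ^ 2 * lamMax Q) with hm
  have hmpos : 0 < m := lt_min htrpos (by positivity)
  have hcomp : complexity Q = lamMax Q * m / lamMin Q := by
    rw [complexity, cond, ← hm]; ring
  refine ⟨by rw [hcomp]; positivity, ?_⟩
  rcases lt_or_ge (∑ i, Q i i) (2 * lamMin Q) with htr | htr
  · exact Or.inl (dotProduct_mulVec_sub_eq_zero_of_trace_lt hQ h0 htr hv)
  right
  have hDv : 0 ≤ v ⬝ᵥ Matrix.diagonal Q.diag *ᵥ v :=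
    (mul_nonneg hmin (Finset.sum_nonneg fun _ _ => mul_self_nonneg _)).trans
      (diagMin_mul_dotProduct_le Q v)
  have key : 2 * (diagMin Q * lamMin Q * (e ⬝ᵥ Q *ᵥ e)) ≤
      lamMax Q * m * (v ⬝ᵥ Matrix.diagonal Q.diag *ᵥ v) := by
    rcases min_choice (∑ i, Q i i) ((2 + 1 / Real.pi * Real.log n) ^ 2 * lamMax Q) with h | h
    · have h1 := lamMin_mul_dotProduct_le_of_strictUpper hQ hmin hv
        (mulVec_sq_le_sum_sq (strictUpper Q) v)
        (Finset.sum_nonneg fun _ _ => Finset.sum_nonneg fun _ _ => sq_nonneg _)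
      have h2 := mul_le_mul_of_nonneg_right (two_mul_add_le_lamMax_mul_trace hQ hmin htr) hDv
      rw [hm, h]
      linarith
    · have h1 := lamMin_mul_dotProduct_le_of_strictUpper hQ hmin hv
        (strictUpper_mulVec_sq_le_of_log (NeZero.pos n) hQ hLpos v) (sq_nonneg _)
      have h2 := mul_le_mul_of_nonneg_right
        (two_mul_add_le_log_sq_mul_lamMax_sq hQ hmin hpos hle) hDv
      rw [hm, h]
      linarith
  rw [hcomp]
  have e1 : 2 * (diagMin Q / (lamMax Q * m / lamMin Q)) * (e ⬝ᵥ Q *ᵥ e) =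
      2 * (diagMin Q * lamMin Q * (e ⬝ᵥ Q *ᵥ e)) / (lamMax Q * m) := by field_simp
  rw [e1, div_le_iff₀ (by positivity)]
  linarith

/-- Any `ρ ≤ L_min / complexity` is admissible: the loss in `1 - 2 ρ ≤ (1 - ρ) ^ 2` is harmless,
so no sign condition on `1 - ρ` enters. -/
theorem IsEpoch.objective_sub_optValue_le [NeZero n] {A : Matrix (Fin n) (Fin n) ℝ}
    {z x x' : Fin n → ℝ} (hA : ∀ i, gram A i i ≠ 0) (h : IsEpoch A (A *ᵥ z) x x') {ρ : ℝ}
    (hρ : 0 < complexity (gram A) → ρ ≤ diagMin (gram A) / complexity (gram A)) :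
    objective A (A *ᵥ z) x' - optValue A (A *ᵥ z) ≤
      (1 - ρ) ^ 2 * (objective A (A *ᵥ z) x - optValue A (A *ᵥ z)) := by
  obtain ⟨y, hy, rfl⟩ := h
  have hQ := gram_posSemidef A
  have hv := hy.lowerPart_mulVec_sub hA
  have h1 := dotProduct_mulVec_correction_le hQ hA hv
  obtain ⟨hc, h2⟩ := two_mul_div_complexity_mul_le hQ hA hv
  have h3 := dotProduct_mulVec_sub_eq hQ.1 hv
  have hE : 0 ≤ (x - z) ⬝ᵥ gram A *ᵥ (x - z) := by
    simpa using hQ.dotProduct_mulVec_nonneg (x - z)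
  rw [optValue_mulVec, objective_mulVec, objective_mulVec, sub_right_comm x _ z]
  set E := (x - z) ⬝ᵥ gram A *ᵥ (x - z)
  rcases h2 with h2 | h2
  · have := mul_nonneg (sq_nonneg (1 - ρ)) hE
    linarith
  · have h4 := mul_le_mul_of_nonneg_right (hρ hc) hE
    have h5 := mul_nonneg (sq_nonneg ρ) hE
    have h6 : (1 - ρ) ^ 2 * (1 / 2 * E - 0) = 1 / 2 * (E - 2 * (ρ * E) + ρ ^ 2 * E) := by ring
    linarith

end Rate

end GBSCD

theorem mainTheorem4 (n : ℕ) [NeZero n] (A : Matrix (Fin n) (Fin n) ℝ) (b : Fin n → ℝ)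
    (hb : b ∈ Set.range (fun x : Fin n → ℝ => A *ᵥ x))
    (hQ : ∀ i, GBSCD.gram A i i ≠ 0)
    (x : ℕ → Fin n → ℝ) (hx : ∀ k, GBSCD.IsEpoch A b (x k) (x (k + 1))) :
    (∀ k, GBSCD.objective A b (x (k + 1)) - GBSCD.optValue A b ≤
        (1 - GBSCD.diagMin (GBSCD.gram A) / GBSCD.complexity (GBSCD.gram A)) ^ 2 *
          (GBSCD.objective A b (x k) - GBSCD.optValue A b)) ∧
    ((∀ i, 1 ≤ GBSCD.gram A i i) →
      ∀ k, GBSCD.objective A b (x (k + 1)) - GBSCD.optValue A b ≤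
        (1 - 1 / GBSCD.complexity (GBSCD.gram A)) ^ 2 *
          (GBSCD.objective A b (x k) - GBSCD.optValue A b)) := by
  obtain ⟨z, rfl⟩ := hb
  refine ⟨fun k => (hx k).objective_sub_optValue_le hQ fun _ => le_rfl, fun h1 k =>
    (hx k).objective_sub_optValue_le hQ fun hc => ?_⟩
  exact div_le_div_of_nonneg_right (le_ciInf h1) hc.le
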